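/- All rings are commutative with $1$. Let $R$ be a Noetherian ring. A flag of prime ideals of $R$ is a non-empty finite set of prime ideals $\Delta=\{\mathfrak p_0\subsetneq\mathfrak p_1\subsetneq\dots\subsetneq\mathfrak p_n\}$, $n\ge 0$. For an $R$-algebra $A$ and a prime $\mathfrak p$ of $R$, let $S_{\mathfrak p}^{-1}A$ be the localization of $A$ at the image of $R\setminus\mathfrak p$, and let $C_{\mathfrak p}A=\varprojlim_m A/\mathfrak p^mA$ be the $\mathfrak p$-adic completion. Put $C_\varnothing R=R$ and $$C_\Delta R=C_{\mathfrak p_0}S_{\mathfrak p_0}^{-1}\cdots C_{\mathfrak p_n}S_{\mathfrak p_n}^{-1}R .$$ For flags $\Delta\subset\Gamma$, or for $\Delta=\varnothing$ and a flag $\Gamma$, the natural homomorphism of $R$-algebras $C_\Delta R\to C_\Gamma R$ is defined recursively, starting from $\mathrm{id}_R$ when both are empty: let $\mathfrak q$ be the smallest prime of $\Gamma$ and $\Gamma'=\Gamma\setminus\{\mathfrak q\}$. If $\mathfrak q\in\Delta$, it is $C_{\mathfrak q}S_{\mathfrak q}^{-1}$ applied to the natural map $C_{\Delta\setminus\{\mathfrak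 q\}}R\to C_{\Gamma'}R$; if $\mathfrak q\notin\Delta$, it is the natural map $C_\Delta R\to C_{\Gamma'}R$ followed by the canonical map $C_{\Gamma'}R\to C_{\mathfrak q}S_{\mathfrak q}^{-1}C_{\Gamma'}R=C_\Gamma R$. Let $\Delta$ and $\Gamma$ be flags of prime ideals of $R$ with $\Delta\subset\Gamma$, or let $\Delta=\varnothing$ and let $\Gamma$ be a flag of prime ideals of $R$. Then the natural ring homomorphism $C_\Delta R\to C_\Gamma R$ is flat. -/

import Mathlib

universe u

noncomputable section

/-- A flag of prime ideals of `R`: a non-empty finite strictly increasing chain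
`p₀ ⊊ p₁ ⊊ ⋯ ⊊ pₙ`, recorded as the list `[p₀, …, pₙ]`. -/
def IsPrimeFlag {R : Type u} [CommRing R] (Δ : List (PrimeSpectrum R)) : Prop :=
  Δ ≠ [] ∧ Δ.Pairwise (· < ·)

namespace IndPro

variable {R : Type u} [CommRing R]

section Step

variable (p : PrimeSpectrum R) (A : Type u) [CommRing A] [Algebra R A]

/-- The localization `S_p⁻¹ A` of an `R`-algebra `A` at (the image of) `R \ p`. -/
abbrev Loc : Type u :=
  Localization (Algebra.algebraMapSubmonoid A p.asIdeal.primeCompl)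

/-- The extension `p · S_p⁻¹ A` of the prime `p` to `S_p⁻¹ A`. -/
abbrev locIdeal : Ideal (Loc p A) := p.asIdeal.map (algebraMap R (Loc p A))

/-- `C_p S_p⁻¹ A`: the `p`-adic completion `lim_n S_p⁻¹ A / pⁿ S_p⁻¹ A` of the localization. -/
abbrev LocComp : Type u := AdicCompletion (locIdeal p A) (Loc p A)

/-- The canonical map `A → S_p⁻¹ A → C_p S_p⁻¹ A`. -/
def toLocComp : A →ₐ[R] LocComp p A :=
  (Algebra.algHom R (Loc p A) (LocComp p A)).comp (Algebra.algHom R A (Loc p A))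

variable {A} {B : Type u} [CommRing B] [Algebra R B]

/-- Functoriality of localization: `S_p⁻¹ φ : S_p⁻¹ A → S_p⁻¹ B`. -/
def locMap (φ : A →ₐ[R] B) : Loc p A →ₐ[R] Loc p B :=
  IsLocalization.liftAlgHom (M := Algebra.algebraMapSubmonoid A p.asIdeal.primeCompl)
    (f := (Algebra.algHom R B (Loc p B)).comp φ) (by
      rintro ⟨_, s, hs, rfl⟩
      have h := IsLocalization.map_units (Loc p B)
        (⟨algebraMap R B s, s, hs, rfl⟩ : Algebra.algebraMapSubmonoid B p.asIdeal.primeCompl)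
      rw [← IsScalarTower.algebraMap_apply R B (Loc p B)] at h
      have e : ((Algebra.algHom R B (Loc p B)).comp φ) (algebraMap R A s) =
        algebraMap R (Loc p B) s := AlgHom.commutes _ s
      exact e ▸ h)

theorem locIdeal_pow_le_comap (φ : A →ₐ[R] B) (n : ℕ) :
    locIdeal p A ^ n ≤ (locIdeal p B ^ n).comap (locMap p φ) := by
  rw [← Ideal.map_le_iff_le_comap, Ideal.map_pow]
  refine Ideal.pow_right_mono ?_ n
  rw [locIdeal, Ideal.map_le_iff_le_comap, Ideal.map_le_iff_le_comap]
  intro r hr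
  rw [Ideal.mem_comap, Ideal.mem_comap, AlgHom.commutes]
  exact Ideal.mem_map_of_mem _ hr

/-- The map `C_p S_p⁻¹ A → S_p⁻¹ A / pⁿ S_p⁻¹ A → S_p⁻¹ B / pⁿ S_p⁻¹ B` induced by `S_p⁻¹ φ`. -/
def locCompMapAux (φ : A →ₐ[R] B) (n : ℕ) : LocComp p A →ₐ[R] Loc p B ⧸ locIdeal p B ^ n :=
  (Ideal.quotientMapₐ (locIdeal p B ^ n) (locMap p φ) (locIdeal_pow_le_comap p φ n)).comp
    ((AdicCompletion.evalₐ (locIdeal p A) n).restrictScalars R)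

theorem factor_comp_locCompMapAux (φ : A →ₐ[R] B) {m n : ℕ} (hmn : m ≤ n) :
    (Ideal.Quotient.factorₐ R (Ideal.pow_le_pow_right hmn)).comp (locCompMapAux p φ n) =
      locCompMapAux p φ m := by
  ext x
  induction x using AdicCompletion.induction_on with
  | h a =>
    have h := congrArg (Ideal.quotientMapₐ (locIdeal p B ^ m) (locMap p φ)
      (locIdeal_pow_le_comap p φ m)) (AdicCompletion.Ideal.mk_eq_mk (locIdeal p A) hmn a)
    simpa [locCompMapAux] using h

/-- Functoriality of `C_p S_p⁻¹`: the limit over `n` of the maps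
`S_p⁻¹ A / pⁿ S_p⁻¹ A → S_p⁻¹ B / pⁿ S_p⁻¹ B` induced by `S_p⁻¹ φ`. -/
def locCompMap (φ : A →ₐ[R] B) : LocComp p A →ₐ[R] LocComp p B :=
  AdicCompletion.liftAlgHom (locIdeal p B) (locCompMapAux p φ) (factor_comp_locCompMapAux p φ)

/-- `locCompMap` is compatible with `A → C_p S_p⁻¹ A` and `B → C_p S_p⁻¹ B`. -/
theorem locCompMap_comp_toLocComp (φ : A →ₐ[R] B) :
    (locCompMap p φ).comp (toLocComp p A) = (toLocComp p B).comp φ := by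
  refine AlgHom.ext fun a => AdicCompletion.ext_evalₐ fun n => ?_
  have h : locMap p φ (algebraMap A (Loc p A) a) = algebraMap B (Loc p B) (φ a) :=
    IsLocalization.lift_eq _ a
  refine (AdicCompletion.evalₐ_liftAlgHom (locIdeal p B) (locCompMapAux p φ)
    (factor_comp_locCompMapAux p φ) n _).trans ?_
  refine Eq.trans (congrArg (Ideal.quotientMapₐ _ (locMap p φ) (locIdeal_pow_le_comap p φ n))
    (AdicCompletion.evalₐ_of (locIdeal p A) n _)) ?_
  refine Eq.trans ?_ (AdicCompletion.evalₐ_of (locIdeal p B) n _).symm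
  exact congrArg (Ideal.Quotient.mk _) h

end Step

/-- `C_Δ R` as an `R`-algebra, by recursion on `Δ = (p₀, …, pₙ)`: it is `R` for the empty flag, and
`C_{p₀} S_{p₀}⁻¹ (C_{(p₁, …, pₙ)} R)` otherwise, so that
`C_Δ R = C_{p₀} S_{p₀}⁻¹ ⋯ C_{pₙ} S_{pₙ}⁻¹ R`. -/
def completionAlg (R : Type u) [CommRing R] : List (PrimeSpectrum R) → CommAlgCat.{u} R
  | [] => CommAlgCat.of R R
  | p :: Δ => CommAlgCat.of R (LocComp p (completionAlg R Δ))

/-- The ind-pro completion `C_Δ R` of `R` along the flag `Δ`. -/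
abbrev Completion (R : Type u) [CommRing R] (Δ : List (PrimeSpectrum R)) : Type u :=
  completionAlg R Δ

open Classical in
/-- The natural map `C_Δ R → C_Γ R` for `Δ` a subflag of `Γ`, by recursion on `Γ = (q, Γ')`.
If `Δ = (q, Δ')` also starts with `q`, it is obtained by applying `C_q S_q⁻¹` to
`C_{Δ'} R → C_{Γ'} R`; otherwise `Δ` is a subflag of `Γ'` and it is the composite
`C_Δ R → C_{Γ'} R → C_q S_q⁻¹ C_{Γ'} R = C_Γ R`. -/
def natMap : (Δ Γ : List (PrimeSpectrum R)) → Δ.Sublist Γ →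
    (Completion R Δ →ₐ[R] Completion R Γ)
  | [], [], _ => AlgHom.id R _
  | [], q :: Γ, _ => (toLocComp q (Completion R Γ)).comp (natMap [] Γ (List.nil_sublist Γ))
  | _ :: _, [], h => absurd h (by simp)
  | p :: Δ, q :: Γ, h =>
    if e : p = q then
      e ▸ locCompMap p (natMap Δ Γ h.of_cons_cons)
    else
      (toLocComp q (Completion R Γ)).comp (natMap (p :: Δ) Γ (by
        cases h with
        | cons _ h => exact h
        | cons_cons _ h => exact absurd rfl e))

/-- Containment of flags, regarded as sets of primes, is the sublist relation. -/
theorem sublist_of_subset {Δ Γ : List (PrimeSpectrum R)} (hΓ : IsPrimeFlag Γ)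
    (h : (IsPrimeFlag Δ ∧ Δ ⊆ Γ) ∨ Δ = []) : Δ.Sublist Γ := by
  rcases h with ⟨hΔ, h⟩ | rfl
  · exact List.sublist_of_subperm_of_pairwise
      (List.subperm_of_subset (hΔ.2.imp fun h => ne_of_lt h) h) hΔ.2 hΓ.2
  · exact List.nil_sublist Γ

end IndPro
end

/-! Induct on `Γ`, removing its smallest prime `q`. The functor $C_qS_q^{-1}$ preserves Noetherian
rings, so every ring in sight is Noetherian and the canonical map $A\to C_qS_q^{-1}A$ is flat. It
remains to see that the functor preserves flatness of $\varphi:A\to B$. Localization does; for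
completion, a relation over $\hat A$ in $\hat B$ is approximated modulo the $n$-th power by one over
$A$ in $B$, where flatness of $\varphi$ trivializes it. Artin–Rees and Krull's intersection theorem
turn triviality modulo all powers into triviality. -/

/-! ### Noetherianity of adic completions -/

/-- The adic completion of a Noetherian ring is Noetherian: it is a quotient of a power series ring
in finitely many variables. -/
theorem AdicCompletion.isNoetherianRing {A : Type*} [CommRing A] [IsNoetherianRing A]
    (I : Ideal A) : IsNoetherianRing (AdicCompletion I A) := by
  obtain ⟨k, g, hg⟩ := Submodule.fg_iff_exists_fin_generating_family.mp (IsNoetherian.noetherian I)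
  let f : MvPolynomial (Fin k) A →+* A := (MvPolynomial.aeval (R := A) g).toRingHom
  let J := MvPolynomial.idealOfVars (Fin k) A
  have hJ : J.map f = I := by
    rw [← hg]
    simp only [J, Ideal.map_span, ← Set.range_comp, Ideal.submodule_span_eq]
    congr 2
    ext i
    simp [f]
  have hle (n : ℕ) : J ^ n ≤ (I ^ n).comap f := by
    rw [← Ideal.map_le_iff_le_comap, Ideal.map_pow, hJ]
  let P := AdicCompletion J (MvPolynomial (Fin k) A)
  have : IsNoetherianRing P := isNoetherianRing_of_ringEquiv _
    (MvPowerSeries.toAdicCompletionAlgEquiv (Fin k) A).toRingEquiv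
  let φ (n : ℕ) : P →+* A ⧸ I ^ n :=
    (Ideal.quotientMap (I ^ n) f (hle n)).comp (AdicCompletion.evalₐ J n).toRingHom
  let F : P →+* AdicCompletion I A := AdicCompletion.liftRingHom I φ (by
    intro m n hmn
    ext x
    induction x using AdicCompletion.induction_on with
    | h a =>
      have h := congrArg (Ideal.quotientMap (I ^ m) f (hle m))
        (AdicCompletion.Ideal.mk_eq_mk J hmn a)
      change Ideal.Quotient.factorPow I hmn (Ideal.quotientMap (I ^ n) f (hle n)
        (AdicCompletion.evalₐ J n (AdicCompletion.mk J _ a))) =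
          Ideal.quotientMap (I ^ m) f (hle m) (AdicCompletion.evalₐ J m (AdicCompletion.mk J _ a))
      rw [AdicCompletion.evalₐ_mk, AdicCompletion.evalₐ_mk]
      exact h)
  have hF (x : MvPolynomial (Fin k) A) :
      F (algebraMap _ P x) = algebraMap A (AdicCompletion I A) (f x) := by
    refine AdicCompletion.ext_evalₐ fun n => ?_
    refine (AdicCompletion.evalₐ_liftRingHom I φ _ n _).trans ?_
    refine (congrArg (Ideal.quotientMap (I ^ n) f (hle n))
      (AdicCompletion.evalₐ_of J n x)).trans ?_
    exact (AdicCompletion.evalₐ_of I n (f x)).symm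
  have hmap : (J.map (algebraMap _ P)).map F = I.map (algebraMap A (AdicCompletion I A)) := by
    have h := congrArg (Ideal.map (algebraMap A (AdicCompletion I A))) hJ
    rw [Ideal.map_map] at h ⊢
    rw [← h]
    congr 1
  have h1 : IsAdicComplete (J.map (algebraMap _ P)) P :=
    (IsAdicComplete.map_algebraMap_iff _ _).mpr
      (AdicCompletion.isAdicComplete (MvPolynomial.idealOfVars_fg _ _))
  have h2 : IsHausdorff ((J.map (algebraMap _ P)).map F) (AdicCompletion I A) := by
    rw [hmap]
    exact IsHausdorff.map_algebraMap_iff.mpr inferInstance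
  have hsurj : Function.Surjective F := by
    -- Since `P` is complete and the target Hausdorff, surjectivity may be checked modulo the ideal,
    -- where constants suffice.
    refine surjective_of_mk_map_comp_surjective F (I := J.map (algebraMap _ P)) ?_
    rintro ⟨y⟩
    obtain ⟨a, ha⟩ := Ideal.Quotient.mk_surjective (AdicCompletion.evalOneₐ I y)
    refine ⟨algebraMap (MvPolynomial (Fin k) A) P (MvPolynomial.C a), ?_⟩
    refine Ideal.Quotient.eq.mpr ?_
    rw [hF, hmap, ← AdicCompletion.ker_evalOneₐ_eq_map _ (IsNoetherian.noetherian I),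
      RingHom.mem_ker]
    simp [f, ← ha, AdicCompletion.algebraMap_apply]
  exact isNoetherianRing_of_surjective P _ F hsurj

/-! ### Local criterion of flatness -/

/-- Local criterion of flatness, in equational form: let `S → T` be a homomorphism of Noetherian
rings and `I` an ideal of `S` whose extension lies in the Jacobson radical of `T`. If every relation
in `T` with coefficients in `S` is trivial modulo each power of `I`, then `T` is flat over `S`. -/
theorem Module.Flat.of_forall_isTrivialRelation_mod_pow {S T : Type*} [CommRing S] [CommRing T]
    [Algebra S T] [IsNoetherianRing S] [IsNoetherianRing T] (I : Ideal S)
    (hI : I.map (algebraMap S T) ≤ Ideal.jacobson ⊥)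
    (H : ∀ (n k : ℕ) (f : Fin k → S) (t : Fin k → T), ∑ i, f i • t i = 0 →
      ∃ (l : ℕ) (a : Fin k → Fin l → S) (y : Fin l → T),
        (∀ i, t i - ∑ j, a i j • y j ∈ I.map (algebraMap S T) ^ n) ∧
          ∀ j, ∑ i, f i * a i j ∈ I ^ n) :
    Module.Flat S T := by
  refine Module.Flat.of_forall_isTrivialRelation fun {k f t} hft => ?_
  obtain ⟨ψ, hψ⟩ : ∃ ψ : (Fin k → S) →ₗ[S] S, ∀ x, ψ x = ∑ i, f i * x i :=
    ⟨Fintype.linearCombination S f, fun x => by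
      simp [Fintype.linearCombination_apply, mul_comm]⟩
  obtain ⟨ι, hι⟩ : ∃ ι : (Fin k → S) →ₗ[S] (Fin k → T), ∀ x i, ι x i = algebraMap S T (x i) :=
    ⟨(Algebra.linearMap S T).compLeft (Fin k), fun _ _ => rfl⟩
  -- The relation `t` is trivial exactly when it is a `T`-combination of relations with entries in
  -- `S`, i.e. lies in `Z`.
  let Z : Submodule T (Fin k → T) := Submodule.span T (ι '' LinearMap.ker ψ)
  let K := I.map (algebraMap S T)
  have hZ : t ∈ Z := by
    -- Krull: the finite module `T^k / Z` is `K`-adically separated, so `t ∈ Z + K ^ n T^k` for all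
    -- `n` suffices.
    have := IsHausdorff.of_le_jacobson K ((Fin k → T) ⧸ Z) hI
    rw [← Submodule.Quotient.mk_eq_zero]
    refine IsHausdorff.haus this _ fun n => SModEq.zero.mpr ?_
    -- Artin–Rees for the ideal generated by the `f i`. Working modulo `I ^ (n + c)` lets each
    -- column of `a` be corrected by some `b j` with entries in `I ^ n` to an exact relation.
    obtain ⟨c, hc⟩ := Ideal.exists_pow_inf_eq_pow_smul I (LinearMap.range ψ)
    obtain ⟨l, a, y, h1, h2⟩ := H (n + c) k f t hft
    have h3 (j : Fin l) : ∃ b : Fin k → S, b ∈ (I ^ n • ⊤ : Submodule S (Fin k → S)) ∧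
        ψ b = ψ (fun i => a i j) := by
      have : ψ (fun i => a i j) ∈ I ^ (n + c) • ⊤ ⊓ LinearMap.range ψ := by
        refine ⟨?_, LinearMap.mem_range_self _ _⟩
        simpa [hψ] using h2 j
      rw [hc _ (Nat.le_add_left c n), Nat.add_sub_cancel] at this
      have h4 := Submodule.smul_mono (le_refl (I ^ n))
        (inf_le_right : I ^ c • ⊤ ⊓ LinearMap.range ψ ≤ LinearMap.range ψ) this
      rw [LinearMap.range_eq_map, ← Submodule.map_smul''] at h4
      exact h4
    choose b hb hbψ using h3
    have hιb (j : Fin l) : ι (b j) ∈ (K ^ n • ⊤ : Submodule T (Fin k → T)) := by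
      have : (I ^ n • ⊤ : Submodule S (Fin k → S)).map ι ≤
          (K ^ n • ⊤ : Submodule T (Fin k → T)).restrictScalars S := by
        rw [Submodule.map_smul'', Submodule.smul_le]
        intro r hr x _
        have hr' : algebraMap S T r ∈ K ^ n := Ideal.map_pow (algebraMap S T) I n ▸
          Ideal.mem_map_of_mem _ hr
        rw [Submodule.restrictScalars_mem, ← algebraMap_smul T r x]
        exact Submodule.smul_mem_smul hr' Submodule.mem_top
      exact this (Submodule.mem_map_of_mem (hb j))
    have hdec : t = (t - ∑ j, y j • ι (fun i => a i j)) + ∑ j, y j • ι (b j) +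
        ∑ j, y j • ι ((fun i => a i j) - b j) := by
      simp only [map_sub, smul_sub, Finset.sum_sub_distrib]
      abel
    have hz : ∑ j, y j • ι ((fun i => a i j) - b j) ∈ Z :=
      Submodule.sum_mem _ fun j _ => Submodule.smul_mem _ _ (Submodule.subset_span
        ⟨_, by simp [hbψ], rfl⟩)
    have hr : (t - ∑ j, y j • ι (fun i => a i j)) + ∑ j, y j • ι (b j) ∈
        (K ^ n • ⊤ : Submodule T (Fin k → T)) := by
      refine add_mem ?_ (Submodule.sum_mem _ fun j _ => Submodule.smul_mem _ _ (hιb j))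
      have h5 (i : Fin k) : (t - ∑ j, y j • ι (fun i => a i j)) i ∈ K ^ (n + c) := by
        simpa [hι, Algebra.smul_def, mul_comm] using h1 i
      rw [pi_eq_sum_univ' (t - ∑ j, y j • ι (fun i => a i j))]
      exact Submodule.sum_mem _ fun i _ => Submodule.smul_mem_smul
        (Ideal.pow_le_pow_right (Nat.le_add_right n c) (h5 i)) Submodule.mem_top
    rw [hdec, Submodule.Quotient.mk_add, (Submodule.Quotient.mk_eq_zero _).mpr hz, add_zero]
    have := Submodule.mem_map_of_mem (f := Z.mkQ) hr
    rw [Submodule.map_smul''] at this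
    exact Submodule.smul_mono le_rfl le_top this
  obtain ⟨l, c, s, hs⟩ := Submodule.mem_span_set'.mp hZ
  choose z hz using fun j => (s j).2
  refine ⟨l, fun i j => z j i, c, fun i => ?_, fun j => ?_⟩
  · have := congrFun hs i
    simp only [← (hz _).2, Finset.sum_apply, Pi.smul_apply, hι] at this
    simpa [Algebra.smul_def, mul_comm] using this.symm
  · rw [← hψ]
    exact (hz j).1

/-! ### Flatness of completed maps -/

/-- For finitely generated `I`, the kernel of the projection to `A / I ^ n` is the extension of `I ^
n`. -/
theorem AdicCompletion.exists_sub_algebraMap_mem {A : Type*} [CommRing A] {I : Ideal A}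
    (hI : I.FG) (n : ℕ) (x : AdicCompletion I A) :
    ∃ a : A, x - algebraMap A (AdicCompletion I A) a ∈
      I.map (algebraMap A (AdicCompletion I A)) ^ n := by
  obtain ⟨a, ha⟩ := Submodule.Quotient.mk_surjective _ (AdicCompletion.eval I A n x)
  refine ⟨a, ?_⟩
  have h : x - algebraMap A (AdicCompletion I A) a ∈ LinearMap.ker (AdicCompletion.eval I A n) := by
    rw [LinearMap.mem_ker, map_sub, ← ha, sub_eq_zero]
    rfl
  rwa [← AdicCompletion.pow_smul_top_eq_ker_eval hI, Ideal.smul_top_eq_map,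
    Submodule.restrictScalars_mem, Ideal.map_pow] at h

theorem AdicCompletion.mem_of_algebraMap_mem {A : Type*} [CommRing A] {I : Ideal A}
    {n : ℕ} {a : A} (h : algebraMap A (AdicCompletion I A) a ∈
      I.map (algebraMap A (AdicCompletion I A)) ^ n) : a ∈ I ^ n := by
  have hle : I.map (algebraMap A (AdicCompletion I A)) ^ n ≤
      RingHom.ker (AdicCompletion.evalₐ I n) := by
    rw [← Ideal.map_pow, Ideal.map_le_iff_le_comap]
    intro b hb
    rw [Ideal.mem_comap, RingHom.mem_ker, AdicCompletion.algebraMap_apply]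
    simpa using Ideal.Quotient.eq_zero_iff_mem.mpr hb
  have := hle h
  rw [RingHom.mem_ker, AdicCompletion.algebraMap_apply] at this
  simpa using Ideal.Quotient.eq_zero_iff_mem.mp ((AdicCompletion.evalₐ_of I n a).symm.trans this)

/-- A relation modulo `I ^ n` in a flat algebra is trivial modulo `I ^ n`. -/
theorem Module.Flat.exists_eq_sum_of_sum_mem_map {A B : Type*} [CommRing A] [CommRing B]
    [Algebra A B] [Module.Flat A B] {L : Ideal A} {k : ℕ} {f : Fin k → A} {t : Fin k → B}
    (h : ∑ i, f i • t i ∈ L.map (algebraMap A B)) :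
    ∃ (l : ℕ) (a : Fin k → Fin l → A) (y : Fin l → B),
      (∀ i, t i = ∑ j, a i j • y j) ∧ ∀ j, ∑ i, f i * a i j ∈ L := by
  obtain ⟨m, c, s, hs⟩ := Submodule.mem_span_set'.mp h
  choose g hg using fun j => (s j).2
  -- Moving the `L`-combination to the left gives an exact relation with extra coefficients `-g j`;
  -- their rows are dropped after trivializing.
  have hrel : ∑ i, (Sum.elim f (fun j => - g j) : Fin k ⊕ Fin m → A) i • Sum.elim t c i = 0 := by
    rw [Fintype.sum_sum_type]
    simp only [Sum.elim_inl, Sum.elim_inr, neg_smul, Finset.sum_neg_distrib]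
    rw [← hs, add_neg_eq_zero]
    refine Finset.sum_congr rfl fun j _ => ?_
    rw [← (hg j).2, Algebra.smul_def (g j), smul_eq_mul, mul_comm]
  obtain ⟨l, a, y, h1, h2⟩ := Module.Flat.isTrivialRelation_of_sum_smul_eq_zero
    (R := A) (M := B) hrel
  refine ⟨l, fun i => a (.inl i), y, fun i => h1 (.inl i), fun j => ?_⟩
  have := h2 j
  simp only [Fintype.sum_sum_type, Sum.elim_inl, Sum.elim_inr, neg_mul, Finset.sum_neg_distrib,
    add_neg_eq_zero] at this
  rw [this]
  exact Ideal.sum_mem _ fun i _ => Ideal.mul_mem_right _ _ (hg i).1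

/-- If `φ : A → B` is a flat homomorphism of Noetherian rings, then the induced homomorphism from the
`I`-adic completion of `A` to the `IB`-adic completion of `B` is flat. -/
theorem RingHom.Flat.adicCompletion {A B : Type*} [CommRing A] [CommRing B] [IsNoetherianRing A]
    [IsNoetherianRing B] {φ : A →+* B} (hφ : φ.Flat) {I : Ideal A} {J : Ideal B}
    (hJ : I.map φ = J) (F : AdicCompletion I A →+* AdicCompletion J B)
    (hF : ∀ a, F (algebraMap A _ a) = algebraMap B _ (φ a)) : F.Flat := by
  have := AdicCompletion.isNoetherianRing I
  have := AdicCompletion.isNoetherianRing J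
  algebraize [φ, F]
  set I' := I.map (algebraMap A (AdicCompletion I A))
  set J' := J.map (algebraMap B (AdicCompletion J B))
  have hIJ : I'.map F = J' := by
    have h := congrArg (Ideal.map (algebraMap B (AdicCompletion J B))) hJ
    rw [Ideal.map_map] at h ⊢
    exact (congrArg (fun g => Ideal.map g I) (RingHom.ext hF)).trans h
  have hmem (n : ℕ) {x : AdicCompletion I A} (hx : x ∈ I' ^ n) : F x ∈ J' ^ n := by
    rw [← hIJ, ← Ideal.map_pow]
    exact Ideal.mem_map_of_mem F hx
  refine Module.Flat.of_forall_isTrivialRelation_mod_pow I' ?_ fun n k f t hft => ?_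
  · have : IsAdicComplete J' (AdicCompletion J B) :=
      (IsAdicComplete.map_algebraMap_iff _ _).mpr
        (AdicCompletion.isAdicComplete (IsNoetherian.noetherian J))
    exact hIJ.le.trans (IsAdicComplete.le_jacobson_bot J')
  · choose f' hf' using fun i =>
      AdicCompletion.exists_sub_algebraMap_mem (IsNoetherian.noetherian I) n (f i)
    choose t' ht' using fun i =>
      AdicCompletion.exists_sub_algebraMap_mem (IsNoetherian.noetherian J) n (t i)
    -- The approximations satisfy the relation modulo `J'^n`, hence modulo `J ^ n` already in `B`.
    have hsum : ∑ i, f' i • t' i ∈ (I ^ n).map (algebraMap A B) := by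
      have e : (I ^ n).map (algebraMap A B) = J ^ n := (Ideal.map_pow _ _ _).trans
        (congrArg (· ^ n) hJ)
      rw [e]
      refine AdicCompletion.mem_of_algebraMap_mem ?_
      have : algebraMap B (AdicCompletion J B) (∑ i, f' i • t' i) =
          -∑ i, (F (f i - algebraMap A _ (f' i)) * algebraMap B _ (t' i) +
            F (f i) * (t i - algebraMap B _ (t' i))) := by
        rw [← sub_eq_zero, sub_neg_eq_add, map_sum, ← Finset.sum_add_distrib, ← hft]
        refine Finset.sum_congr rfl fun i _ => ?_
        rw [Algebra.smul_def, Algebra.smul_def, map_mul, map_sub, hF]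
        simp only [RingHom.algebraMap_toAlgebra]
        ring
      rw [this]
      exact neg_mem (Ideal.sum_mem _ fun i _ => add_mem
        (Ideal.mul_mem_right _ _ (hmem n (hf' i))) (Ideal.mul_mem_left _ _ (ht' i)))
    obtain ⟨l, a, y, h1, h2⟩ := Module.Flat.exists_eq_sum_of_sum_mem_map hsum
    refine ⟨l, fun i j => algebraMap A _ (a i j), fun j => algebraMap B _ (y j),
      fun i => ?_, fun j => ?_⟩
    · have e : ∑ j, algebraMap A (AdicCompletion I A) (a i j) •
          algebraMap B (AdicCompletion J B) (y j) = algebraMap B _ (t' i) := by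
        rw [h1 i, map_sum]
        refine Finset.sum_congr rfl fun j _ => ?_
        rw [Algebra.smul_def, Algebra.smul_def, map_mul]
        exact congrArg (· * _) (hF _)
      rw [e]
      exact hIJ.symm ▸ ht' i
    · have e : ∑ i, f i * algebraMap A (AdicCompletion I A) (a i j) =
          algebraMap A _ (∑ i, f' i * a i j) +
            ∑ i, (f i - algebraMap A _ (f' i)) * algebraMap A _ (a i j) := by
        rw [map_sum, ← Finset.sum_add_distrib]
        refine Finset.sum_congr rfl fun i _ => ?_
        rw [map_mul]
        ring
      rw [e]
      refine add_mem ?_ (Ideal.sum_mem _ fun i _ => Ideal.mul_mem_right _ _ (hf' i))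
      rw [← Ideal.map_pow]
      exact Ideal.mem_map_of_mem _ (h2 j)

/-! ### Flatness along flags -/

namespace IndPro

variable {R : Type u} [CommRing R]

theorem locCompMap_algebraMap (p : PrimeSpectrum R) {A B : Type u} [CommRing A] [Algebra R A]
    [CommRing B] [Algebra R B] (φ : A →ₐ[R] B) (x : Loc p A) :
    locCompMap p φ (algebraMap (Loc p A) (LocComp p A) x) =
      algebraMap (Loc p B) (LocComp p B) (locMap p φ x) := by
  refine AdicCompletion.ext_evalₐ fun n => ?_
  refine (AdicCompletion.evalₐ_liftAlgHom (locIdeal p B) (locCompMapAux p φ)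
    (factor_comp_locCompMapAux p φ) n _).trans ?_
  refine Eq.trans (congrArg (Ideal.quotientMapₐ _ (locMap p φ) (locIdeal_pow_le_comap p φ n))
    (AdicCompletion.evalₐ_of (locIdeal p A) n _)) ?_
  exact (AdicCompletion.evalₐ_of (locIdeal p B) n _).symm

theorem map_locIdeal (p : PrimeSpectrum R) {A B : Type u} [CommRing A] [Algebra R A]
    [CommRing B] [Algebra R B] (φ : A →ₐ[R] B) :
    (locIdeal p A).map (locMap p φ).toRingHom = locIdeal p B := by
  rw [locIdeal, locIdeal, Ideal.map_map]
  exact congrArg (fun g => Ideal.map g p.asIdeal) (locMap p φ).comp_algebraMap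

/-- For a module over a localization of `A`, flatness there is the same as flatness over `A`. -/
theorem flat_locMap (p : PrimeSpectrum R) {A B : Type u} [CommRing A] [Algebra R A]
    [CommRing B] [Algebra R B] {φ : A →ₐ[R] B} (hφ : φ.toRingHom.Flat) :
    (locMap p φ).toRingHom.Flat := by
  let M := Algebra.algebraMapSubmonoid A p.asIdeal.primeCompl
  have hcomp : (locMap p φ).toRingHom.comp (algebraMap A (Loc p A)) =
      (algebraMap B (Loc p B)).comp φ.toRingHom :=
    RingHom.ext fun a => IsLocalization.lift_eq _ a
  have hflat : ((algebraMap B (Loc p B)).comp φ.toRingHom).Flat :=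
    hφ.comp (RingHom.flat_algebraMap_iff.mpr inferInstance)
  rw [← hcomp] at hflat
  algebraize [(locMap p φ).toRingHom, (locMap p φ).toRingHom.comp (algebraMap A (Loc p A))]
  have : IsScalarTower A (Loc p A) (Loc p B) := .of_algebraMap_eq fun _ => rfl
  exact (Module.flat_iff_of_isLocalization (Loc p A) M _).mpr hflat

instance isNoetherianRing_loc (p : PrimeSpectrum R) (A : Type u) [CommRing A] [Algebra R A]
    [IsNoetherianRing A] : IsNoetherianRing (Loc p A) :=
  IsLocalization.isNoetherianRing
    (Algebra.algebraMapSubmonoid A p.asIdeal.primeCompl) _ inferInstance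

theorem isNoetherianRing_locComp (p : PrimeSpectrum R) (A : Type u) [CommRing A] [Algebra R A]
    [IsNoetherianRing A] : IsNoetherianRing (LocComp p A) :=
  AdicCompletion.isNoetherianRing (locIdeal p A)

theorem flat_locCompMap (p : PrimeSpectrum R) {A B : Type u} [CommRing A] [Algebra R A]
    [CommRing B] [Algebra R B] [IsNoetherianRing A] [IsNoetherianRing B] {φ : A →ₐ[R] B}
    (hφ : φ.toRingHom.Flat) : (locCompMap p φ).toRingHom.Flat :=
  (flat_locMap p hφ).adicCompletion (map_locIdeal p φ) _ (locCompMap_algebraMap p φ)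

theorem flat_toLocComp (p : PrimeSpectrum R) (A : Type u) [CommRing A] [Algebra R A]
    [IsNoetherianRing A] : (toLocComp p A).toRingHom.Flat := by
  have h1 : (algebraMap A (Loc p A)).Flat := RingHom.flat_algebraMap_iff.mpr inferInstance
  have h2 : (algebraMap (Loc p A) (LocComp p A)).Flat :=
    RingHom.flat_algebraMap_iff.mpr (AdicCompletion.flat_of_isNoetherian _)
  exact h1.comp h2

instance isNoetherianRing_completion [IsNoetherianRing R] (Δ : List (PrimeSpectrum R)) :
    IsNoetherianRing (Completion R Δ) := by
  induction Δ with
  | nil => exact ‹IsNoetherianRing R›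
  | cons p Δ ih =>
    exact isNoetherianRing_locComp p (Completion R Δ)

theorem natMap_cons_of_ne {p q : PrimeSpectrum R} {Δ Γ : List (PrimeSpectrum R)}
    (e : p ≠ q) (h : (p :: Δ).Sublist (q :: Γ)) (h' : (p :: Δ).Sublist Γ) :
    natMap (p :: Δ) (q :: Γ) h =
      (toLocComp q (Completion R Γ)).comp (natMap (p :: Δ) Γ h') := by
  rw [natMap]
  exact dif_neg e

theorem natMap_cons_self (p : PrimeSpectrum R) {Δ Γ : List (PrimeSpectrum R)}
    (h : (p :: Δ).Sublist (p :: Γ)) :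
    natMap (p :: Δ) (p :: Γ) h = locCompMap p (natMap Δ Γ h.of_cons_cons) := by
  rw [natMap]
  exact dif_pos rfl

theorem flat_toLocComp_comp [IsNoetherianRing R] (q : PrimeSpectrum R)
    {A : Type u} [CommRing A] [Algebra R A] {Γ : List (PrimeSpectrum R)}
    {f : A →ₐ[R] Completion R Γ} (hf : f.toRingHom.Flat) :
    ((toLocComp q (Completion R Γ)).comp f :
      A →ₐ[R] Completion R (q :: Γ)).toRingHom.Flat :=
  RingHom.Flat.comp (f := f.toRingHom) (g := (toLocComp q (Completion R Γ)).toRingHom)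
    hf (flat_toLocComp q _)

theorem flat_natMap [IsNoetherianRing R] (Δ Γ : List (PrimeSpectrum R)) (h : Δ.Sublist Γ) :
    (natMap Δ Γ h).toRingHom.Flat := by
  -- `Δ` varies because it loses its head only when that head is `q`.
  induction Γ generalizing Δ with
  | nil =>
    obtain rfl := List.sublist_nil.mp h
    exact RingHom.Flat.id _
  | cons q Γ ih =>
    cases Δ with
    | nil => exact flat_toLocComp_comp q (ih [] _)
    | cons p Δ =>
      by_cases e : p = q
      · subst e
        exact (natMap_cons_self p h).symm ▸ flat_locCompMap p (ih Δ _)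
      · have h' : (p :: Δ).Sublist Γ := by
          cases h with
          | cons _ h => exact h
          | cons_cons _ h => exact absurd rfl e
        have := flat_toLocComp_comp q (ih (p :: Δ) h')
        exact (natMap_cons_of_ne e h h').symm ▸ this
end IndPro

theorem mainTheorem11 {R : Type u} [CommRing R] [IsNoetherianRing R]
    (Δ Γ : List (PrimeSpectrum R)) (hΓ : IsPrimeFlag Γ)
    (h : (IsPrimeFlag Δ ∧ Δ ⊆ Γ) ∨ Δ = []) :
    (IndPro.natMap Δ Γ (IndPro.sublist_of_subset hΓ h)).toRingHom.Flat :=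
  IndPro.flat_natMap Δ Γ _
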